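/- Let $(P,\{\cdot,\cdot\})$ be a (Hausdorff, finite-dimensional, smooth) Poisson manifold, that is, $\{\cdot,\cdot\}$ is a Lie bracket on $C^\infty(P)$ which is a derivation in each entry. Let $H\in C^\infty(P)$, let $X_H$ be its Hamiltonian vector field, defined by $X_H[F]=\{F,H\}$ for all $F\in C^\infty(P)$, and let $z_e\in P$ be an equilibrium, $X_H(z_e)=0$. Let $L:T_{z_e}P\to T_{z_e}P$ be the linearization of $X_H$ at $z_e$. Let $(q^1,\dots,q^n,p_1,\dots,p_n,z^1,\dots,z^r)$ be Darboux–Weinstein coordinates on an open set $U\ni z_e$: a smooth chart that sends $z_e$ to $0$ such that on $U$ $$\{q^i,q^j\}=\{p_i,p_j\}=\{q^i,z^k\}=\{p_i,z^k\}=0,\qquad \{q^i,p_j\}=\delta^i_j,$$ and such that each $\{z^k,z^l\}$ is a function of $z^1,\dots,z^r$ only and vanishes at $z_e$. In the coordinates $(x,z)$ with $x=(q,p)$, the matrix of $L$ has the block form $$L=\begin{pmatrix}\mathcal S&\mathcal Q\\0&\mathcal P\end{pmatrix},$$ where $\mathcal S$ is $2n\times 2n$ and $\mathcal P$ is $r\times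 r$. One says that $L$ exhibits a *coupled passing* if there are $\mu\in\mathbb C$ and an eigenvector $v\in\mathbb C^r\setminus\{0\}$ with $\mathcal P v=\mu v$ such that $\mu$ is also an eigenvalue of $\mathcal S$ and the preimage $$(\mathcal S-\mu I)^{-1}\mathcal Q v:=\{w\in\mathbb C^{2n} : (\mathcal S-\mu I)w=\mathcal Q v\}$$ is empty. **Proposition.** If $L$ exhibits a coupled passing, then $z_e$ is linearly unstable: the origin is an unstable (that is, not Lyapunov stable) equilibrium of the linear dynamical system $\dot v=Lv$ on $T_{z_e}P$. -/

import Mathlib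

open scoped Manifold ContDiff Topology

noncomputable section

namespace PoissonDynamics

/-- A parameter integral over `[0, 1]` of a smooth function is smooth. -/
theorem contDiff_paramIntegral.{u} {E : Type u} [NormedAddCommGroup E] [NormedSpace ℝ E]
    [FiniteDimensional ℝ E] (n : ℕ) : ∀ {F : Type u} [NormedAddCommGroup F] [NormedSpace ℝ F]
    [CompleteSpace F] (K : E → ℝ → F), ContDiff ℝ ∞ (fun p : E × ℝ => K p.1 p.2) →
      ContDiff ℝ n (fun y => ∫ t in (0:ℝ)..1, K y t) := by
  induction n with
  | zero =>
    intro F _ _ _ K hK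
    have : Continuous (Function.uncurry K) := hK.continuous
    exact contDiff_zero.2 (intervalIntegral.continuous_parametric_intervalIntegral_of_continuous' this 0 1)
  | succ n ih =>
    intro F _ _ _ K hK
    let K' : E → ℝ → (E →L[ℝ] F) := fun y t => (fderiv ℝ (fun p : E × ℝ => K p.1 p.2) (y, t)).comp
      (ContinuousLinearMap.inl ℝ E ℝ)
    have hK' : ContDiff ℝ ∞ (fun p : E × ℝ => K' p.1 p.2) :=
      (hK.fderiv_right (m := ∞) (by simp)).clm_comp contDiff_const
    have hd : ∀ y, HasFDerivAt (fun y => ∫ t in (0:ℝ)..1, K y t) (∫ t in (0:ℝ)..1, K' y t) y := by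
      intro y
      have hc : Continuous (Function.uncurry K') := hK'.continuous
      obtain ⟨C, hC⟩ := ((isCompact_closedBall y 1).prod (isCompact_Icc (a := (0:ℝ)) (b := 1))).exists_bound_of_continuousOn
        hc.continuousOn
      refine intervalIntegral.hasFDerivAt_integral_of_dominated_of_fderiv_le (bound := fun _ => C)
        (Metric.closedBall_mem_nhds y one_pos) ?_ ?_ ?_ ?_ ?_ ?_
      · refine Filter.Eventually.of_forall fun x => ?_
        exact (hK.continuous.comp (by fun_prop : Continuous fun t : ℝ => (x, t))).aestronglyMeasurable
      · exact (hK.continuous.comp (by fun_prop : Continuous fun t : ℝ => (y, t))).intervalIntegrable _ _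
      · exact (hK'.continuous.comp (by fun_prop : Continuous fun t : ℝ => (y, t))).aestronglyMeasurable
      · refine Filter.Eventually.of_forall fun t ht x hx => hC (x, t) ⟨hx, ?_⟩
        rw [Set.uIoc_of_le zero_le_one] at ht
        exact ⟨ht.1.le, ht.2⟩
      · simp
      · refine Filter.Eventually.of_forall fun t ht x hx => ?_
        have h1 := (hK.differentiable (by simp) (x, t)).hasFDerivAt
        exact HasFDerivAt.comp (g := fun p : E × ℝ => K p.1 p.2) (f := fun e : E => (e, t)) x h1
          (hasFDerivAt_prodMk_left x t)
    rw [show ((n + 1 : ℕ) : WithTop ℕ∞) = (n : WithTop ℕ∞) + 1 by norm_cast,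
      contDiff_succ_iff_fderiv]
    refine ⟨fun y => (hd y).differentiableAt, by simp, ?_⟩
    rw [show fderiv ℝ (fun y => ∫ t in (0:ℝ)..1, K y t) = fun y => ∫ t in (0:ℝ)..1, K' y t from
      funext fun y => (hd y).fderiv]
    exact ih K' hK'

/-- Hadamard's lemma. -/
theorem exists_hadamard_factor {E : Type*} [NormedAddCommGroup E] [NormedSpace ℝ E]
    [FiniteDimensional ℝ E] (g : E → ℝ) (hg : ContDiff ℝ ∞ g) (a : E) :
    ∃ h : E → (E →L[ℝ] ℝ), ContDiff ℝ ∞ h ∧ h a = fderiv ℝ g a ∧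
      ∀ y, g y = g a + h y (y - a) := by
  have hK : ContDiff ℝ ∞ (fun p : E × ℝ => fderiv ℝ g (a + p.2 • (p.1 - a))) :=
    (hg.fderiv_right (m := ∞) (by simp)).comp (by fun_prop)
  refine ⟨fun y => ∫ t in (0:ℝ)..1, fderiv ℝ g (a + t • (y - a)), ?_, by simp, fun y => ?_⟩
  · exact contDiff_infty.2 fun n => contDiff_paramIntegral n _ hK
  · have hc : Continuous fun t : ℝ => fderiv ℝ g (a + t • (y - a)) :=
      hK.continuous.comp (by fun_prop : Continuous fun t : ℝ => (y, t))
    rw [ContinuousLinearMap.intervalIntegral_apply (hc.intervalIntegrable _ _)]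
    have := intervalIntegral.integral_eq_sub_of_hasDerivAt (a := 0) (b := 1)
      (f := fun t : ℝ => g (a + t • (y - a)))
      (f' := fun t => fderiv ℝ g (a + t • (y - a)) (y - a)) (fun t _ => ?_)
      ((hc.clm_apply continuous_const).intervalIntegrable _ _)
    · rw [this]; simp
    · have h1 := (hg.differentiable (by simp) (a + t • (y - a))).hasFDerivAt
      have h2 : HasDerivAt (fun t : ℝ => a + t • (y - a)) (y - a) t := by
        simpa using ((hasDerivAt_id t).smul_const (y - a)).const_add a
      exact h1.comp_hasDerivAt t h2

/-- A derivation at `z` of the algebra of smooth functions is given by a tangent vector. -/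
theorem exists_tangentVector_of_derivation {E : Type*} [NormedAddCommGroup E] [NormedSpace ℝ E] [FiniteDimensional ℝ E]
    {M : Type*} [TopologicalSpace M] [T2Space M] [ChartedSpace E M] [IsManifold 𝓘(ℝ, E) ∞ M]
    (z : M) (D : C^∞⟮𝓘(ℝ, E), M; ℝ⟯ →ₗ[ℝ] ℝ)
    (hD : ∀ f g, D (f * g) = f z * D g + g z * D f) :
    ∃ v : TangentSpace 𝓘(ℝ, E) z, ∀ f : C^∞⟮𝓘(ℝ, E), M; ℝ⟯,
      mfderiv 𝓘(ℝ, E) 𝓘(ℝ, ℝ) f z v = D f := by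
  set x := extChartAt 𝓘(ℝ, E) z with hx
  set a := x z with ha
  have hT : x.target ∈ 𝓝 a := by
    exact extChartAt_target_mem_nhds (I := 𝓘(ℝ, E)) z
  obtain ⟨ε, hε, hεT⟩ := Metric.nhds_basis_closedBall.mem_iff.1 hT
  let ψ : ContDiffBump a := ⟨ε / 2, ε, by positivity, by linarith⟩
  have hs : x.source ∈ 𝓝 z := extChartAt_source_mem_nhds z
  have hN : x.source ∩ x ⁻¹' (Metric.ball a (ε / 2)) ∈ 𝓝 z :=
    Filter.inter_mem hs ((continuousAt_extChartAt z).preimage_mem_nhds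
      (Metric.ball_mem_nhds _ (by positivity)))
  obtain ⟨χ, -, hχ⟩ := (SmoothBumpFunction.nhds_basis_support (I := 𝓘(ℝ, E)) hN).mem_iff.1 hN
  have hχz : χ z = 1 := χ.eq_one
  -- extension of coordinate functions
  have hsm : ∀ u : E → ℝ, ContDiff ℝ ∞ u → ContMDiff 𝓘(ℝ, E) 𝓘(ℝ, ℝ) ∞ (fun w => χ w * u (x w)) := by
    intro u hu
    have := χ.contMDiff_smul (g := fun w => u (x w)) (hu.contMDiff.comp_contMDiffOn
      (contMDiffOn_extChartAt (I := 𝓘(ℝ, E)) (x := z) (n := ∞)))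
    simpa using this
  let ext : (u : E → ℝ) → ContDiff ℝ ∞ u → C^∞⟮𝓘(ℝ, E), M; ℝ⟯ := fun u hu => ⟨_, hsm u hu⟩
  have hone : D 1 = 0 := by
    have := hD 1 1
    simp at this
    exact this
  have hconst : ∀ c : ℝ, D (algebraMap ℝ _ c) = 0 := fun c => by
    rw [Algebra.algebraMap_eq_smul_one, map_smul, hone, smul_zero]
  let b := Module.finBasis ℝ E
  let l : Fin (Module.finrank ℝ E) → (E →L[ℝ] ℝ) := fun i => LinearMap.toContinuousLinearMap (b.coord i)
  have hl : ∀ i, ContDiff ℝ ∞ (fun y : E => l i (y - a)) := fun i => by fun_prop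
  let v : E := ∑ i, D (ext _ (hl i)) • b i
  refine ⟨v, fun f => ?_⟩
  -- the local representative of `f`
  have hg : ContDiff ℝ ∞ (fun y => ψ y * f (x.symm y)) := by
    rw [contDiff_iff_contDiffAt]
    intro y
    by_cases hy : y ∈ tsupport ψ
    · have hyT : y ∈ x.target := by
        apply hεT
        rw [ψ.tsupport_eq] at hy
        exact hy
      have h1 : ContMDiffAt 𝓘(ℝ, E) 𝓘(ℝ, ℝ) ∞ (fun y => f (x.symm y)) y :=
        (f.contMDiff (x.symm y)).comp y
          ((contMDiffOn_extChartAt_symm (I := 𝓘(ℝ, E)) (n := ∞) z).contMDiffAt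
            ((isOpen_extChartAt_target z).mem_nhds hyT))
      exact ψ.contDiffAt.mul h1.contDiffAt
    · have : (fun y => ψ y * f (x.symm y)) =ᶠ[𝓝 y] fun _ => 0 := by
        filter_upwards [(isClosed_tsupport ψ).isOpen_compl.mem_nhds hy] with w hw
        rw [image_eq_zero_of_notMem_tsupport hw, zero_mul]
      exact contDiffAt_const.congr_of_eventuallyEq this
  obtain ⟨h, hh, hha, hhy⟩ := exists_hadamard_factor _ hg a
  have hga : (fun y => ψ y * f (x.symm y)) a = f z := by
    have h1 : ψ a = 1 := ψ.one_of_mem_closedBall (Metric.mem_closedBall_self ψ.rIn_pos.le)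
    have h2 : x.symm a = z := extChartAt_to_inv z
    simp only [h1, h2, one_mul]
  have hb : ∀ i, ContDiff ℝ ∞ (fun y : E => h y (b i)) := fun i => hh.clm_apply contDiff_const
  let X : C^∞⟮𝓘(ℝ, E), M; ℝ⟯ := ⟨χ, χ.contMDiff⟩
  have key : X * X * (f - algebraMap ℝ _ (f z)) = ∑ i, ext _ (hb i) * ext _ (hl i) := by
    ext w
    have hR : (∑ i, ext _ (hb i) * ext _ (hl i)) w
        = ∑ i, (χ w * h (x w) (b i)) * (χ w * l i (x w - a)) := by
      have h1 := map_sum (ContMDiffMap.coeFnAddMonoidHom (I := 𝓘(ℝ, E)) (N := M) (I' := 𝓘(ℝ, ℝ))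
        (G := ℝ) (n := ∞)) (fun i => ext _ (hb i) * ext _ (hl i)) Finset.univ
      have h2 := congrFun h1 w
      rw [Finset.sum_apply] at h2
      exact h2
    have hL : (X * X * (f - algebraMap ℝ _ (f z))) w = χ w * χ w * (f w - f z) := rfl
    rw [hL, hR]
    by_cases hw : w ∈ Function.support χ
    · obtain ⟨hws, hwb⟩ := hχ hw
      have h1 : (fun y => ψ y * f (x.symm y)) (x w)
          = (fun y => ψ y * f (x.symm y)) a + h (x w) (x w - a) := hhy (x w)
      have h2 : ψ (x w) = 1 := ψ.one_of_mem_closedBall (Metric.ball_subset_closedBall hwb)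
      rw [hga] at h1
      simp only [h2, one_mul, x.left_inv hws] at h1
      have h3 : h (x w) (x w - a) = ∑ i, l i (x w - a) * h (x w) (b i) := by
        conv_lhs => rw [← b.sum_repr (x w - a)]
        simp [l]
      rw [h1, h3, add_sub_cancel_left, Finset.mul_sum]
      exact Finset.sum_congr rfl fun i _ => by ring
    · rw [Function.notMem_support] at hw
      simp [hw]
  have hD1 := congrArg D key
  rw [map_sum] at hD1
  have e1 : D (X * X * (f - algebraMap ℝ _ (f z))) = D f := by
    rw [hD, map_sub, hconst, sub_zero]
    have : (X * X) z = 1 := by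
      change χ z * χ z = 1
      rw [hχz, one_mul]
    have h2 : (f - algebraMap ℝ _ (f z)) z = 0 := by
      change f z - f z = 0
      simp
    rw [this, h2]; simp
  have e2 : ∀ i, D (ext _ (hb i) * ext _ (hl i)) = h a (b i) * D (ext _ (hl i)) := by
    intro i
    rw [hD]
    have h1 : (ext _ (hb i)) z = h a (b i) := by
      change χ z * h a (b i) = _
      rw [hχz, one_mul]
    have h2 : (ext _ (hl i)) z = 0 := by
      change χ z * l i (a - a) = 0
      simp
    rw [h1, h2]; simp
  rw [e1] at hD1
  rw [hD1]
  have hm : mfderiv 𝓘(ℝ, E) 𝓘(ℝ, ℝ) f z = fderiv ℝ (fun y => ψ y * f (x.symm y)) a := by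
    rw [(f.contMDiff.mdifferentiable (by simp) z).mfderiv]
    simp only [modelWithCornersSelf_coe, Set.range_id, fderivWithin_univ]
    apply Filter.EventuallyEq.fderiv_eq
    filter_upwards [ψ.eventuallyEq_one] with y hy
    have hy' : ψ y = 1 := hy
    simp only [hy', one_mul]
    rfl
  rw [hm, ← hha]
  change h a v = _
  simp only [v, map_sum, map_smul, smul_eq_mul]
  exact Finset.sum_congr rfl fun i _ => by rw [e2]; ring

section Poisson

variable (E : Type*) [NormedAddCommGroup E] [NormedSpace ℝ E]
  (M : Type*) [TopologicalSpace M] [ChartedSpace E M]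

/-- A Poisson structure on the manifold `M`: a bilinear bracket on the smooth functions that is a
Lie bracket and a derivation in each entry (the second entry by skew-symmetry). -/
structure PoissonStructure where
  bracket : C^∞⟮𝓘(ℝ, E), M; ℝ⟯ →ₗ[ℝ] C^∞⟮𝓘(ℝ, E), M; ℝ⟯ →ₗ[ℝ] C^∞⟮𝓘(ℝ, E), M; ℝ⟯
  skew : ∀ F G, bracket F G = -bracket G F
  jacobi : ∀ F G K,
    bracket F (bracket G K) + bracket G (bracket K F) + bracket K (bracket F G) = 0
  leibniz : ∀ F G K, bracket (F * G) K = F * bracket G K + G * bracket F K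

end Poisson

variable {E : Type*} [NormedAddCommGroup E] [NormedSpace ℝ E]
  {M : Type*} [TopologicalSpace M] [ChartedSpace E M]

theorem PoissonStructure.exists_hamiltonianVector [FiniteDimensional ℝ E] [T2Space M]
    [IsManifold 𝓘(ℝ, E) ∞ M] (B : PoissonStructure E M) (H : C^∞⟮𝓘(ℝ, E), M; ℝ⟯) (z : M) :
    ∃ v : TangentSpace 𝓘(ℝ, E) z, ∀ F : C^∞⟮𝓘(ℝ, E), M; ℝ⟯,
      mfderiv 𝓘(ℝ, E) 𝓘(ℝ, ℝ) F z v = B.bracket F H z := by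
  refine exists_tangentVector_of_derivation z
    { toFun := fun F => B.bracket F H z
      map_add' := fun F G => ?_
      map_smul' := fun c F => ?_ } fun F G => ?_
  · rw [map_add]; rfl
  · rw [map_smul]; rfl
  · change B.bracket (F * G) H z = _
    rw [B.leibniz]; rfl

/-- The Hamiltonian vector field `X_H`: `X_H(z)` is the tangent vector with
`X_H[F](z) = {F, H}(z)` for every smooth `F`. -/
def PoissonStructure.hamiltonianVectorField [FiniteDimensional ℝ E] [T2Space M]
    [IsManifold 𝓘(ℝ, E) ∞ M] (B : PoissonStructure E M) (H : C^∞⟮𝓘(ℝ, E), M; ℝ⟯) (z : M) :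
    TangentSpace 𝓘(ℝ, E) z :=
  Classical.choose (B.exists_hamiltonianVector H z)

/-- The defining property of the Hamiltonian vector field. -/
theorem PoissonStructure.mfderiv_hamiltonianVectorField [FiniteDimensional ℝ E] [T2Space M]
    [IsManifold 𝓘(ℝ, E) ∞ M] (B : PoissonStructure E M) (F H : C^∞⟮𝓘(ℝ, E), M; ℝ⟯) (z : M) :
    mfderiv 𝓘(ℝ, E) 𝓘(ℝ, ℝ) F z (B.hamiltonianVectorField H z) = B.bracket F H z :=
  Classical.choose_spec (B.exists_hamiltonianVector H z) F

/-- The bracket, at the point `w`, of two functions that are only defined and smooth near `w`: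
it equals `c` when `{F, G}(w) = c` for global smooth functions `F`, `G` that agree with `f`, `g`
near `w`. (Such extensions exist, and the value does not depend on them.) -/
def PoissonStructure.HasLocalBracket (B : PoissonStructure E M) (f g : M → ℝ) (w : M) (c : ℝ) :
    Prop :=
  ∃ F G : C^∞⟮𝓘(ℝ, E), M; ℝ⟯, F =ᶠ[𝓝 w] f ∧ G =ᶠ[𝓝 w] g ∧ B.bracket F G w = c

/-- Indices of the coordinates `(q, p, z)`, with `q, p ∈ ℝ^n` and `z ∈ ℝ^r`. The coordinates
`x = (q, p)` form the left summand. -/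
abbrev DWIndex (n r : ℕ) : Type := (Fin n ⊕ Fin n) ⊕ Fin r

/-- Darboux-Weinstein charts `φ = (q, p, z)` of the Poisson manifold around the point `z₀`. -/
structure PoissonStructure.IsDarbouxWeinsteinChart (B : PoissonStructure E M) {n r : ℕ}
    (φ : OpenPartialHomeomorph M (DWIndex n r → ℝ)) (z₀ : M) : Prop where
  mem_source : z₀ ∈ φ.source
  map_point : φ z₀ = 0
  contMDiffOn : ContMDiffOn 𝓘(ℝ, E) 𝓘(ℝ, DWIndex n r → ℝ) ∞ φ φ.source
  contMDiffOn_symm : ContMDiffOn 𝓘(ℝ, DWIndex n r → ℝ) 𝓘(ℝ, E) ∞ φ.symm φ.target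
  bracket_qq : ∀ w ∈ φ.source, ∀ i j : Fin n,
    B.HasLocalBracket (fun y => φ y (.inl (.inl i))) (fun y => φ y (.inl (.inl j))) w 0
  bracket_pp : ∀ w ∈ φ.source, ∀ i j : Fin n,
    B.HasLocalBracket (fun y => φ y (.inl (.inr i))) (fun y => φ y (.inl (.inr j))) w 0
  bracket_qp : ∀ w ∈ φ.source, ∀ i j : Fin n,
    B.HasLocalBracket (fun y => φ y (.inl (.inl i))) (fun y => φ y (.inl (.inr j))) w
      (if i = j then 1 else 0)
  bracket_qz : ∀ w ∈ φ.source, ∀ (i : Fin n) (k : Fin r),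
    B.HasLocalBracket (fun y => φ y (.inl (.inl i))) (fun y => φ y (.inr k)) w 0
  bracket_pz : ∀ w ∈ φ.source, ∀ (i : Fin n) (k : Fin r),
    B.HasLocalBracket (fun y => φ y (.inl (.inr i))) (fun y => φ y (.inr k)) w 0
  /-- The brackets of the transverse coordinates depend on these coordinates only, and vanish at
  the base point. -/
  bracket_zz : ∃ R : (Fin r → ℝ) → Matrix (Fin r) (Fin r) ℝ, R 0 = 0 ∧
    ∀ w ∈ φ.source, ∀ k l : Fin r,
      B.HasLocalBracket (fun y => φ y (.inr k)) (fun y => φ y (.inr l)) w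
        (R (fun m => φ w (.inr m)) k l)

/-- The linearization at a zero `z₀` of the vector field `X`, as an endomorphism of the tangent
space at `z₀`: the derivative at `z₀` of `X` read in the trivialization of the tangent bundle
given by the preferred chart at `z₀` (which is the identity on the fibre over `z₀`). -/
def linearization [IsManifold 𝓘(ℝ, E) ∞ M] (X : (w : M) → TangentSpace 𝓘(ℝ, E) w) (z₀ : M) :
    TangentSpace 𝓘(ℝ, E) z₀ →L[ℝ] TangentSpace 𝓘(ℝ, E) z₀ :=
  haveI : IsManifold 𝓘(ℝ, E) 1 M := IsManifold.of_le (n := ∞) (by simp)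
  mfderiv 𝓘(ℝ, E) 𝓘(ℝ, E)
    (fun w => (trivializationAt E (TangentSpace 𝓘(ℝ, E)) z₀ ⟨w, X w⟩).2) z₀

/-- The matrix of an endomorphism `L` of the tangent space at `z₀` in the basis of coordinate
vectors of the chart `φ`. -/
def matrixInChart {ι : Type*} [Fintype ι] [DecidableEq ι] (φ : OpenPartialHomeomorph M (ι → ℝ))
    (z₀ : M) (L : TangentSpace 𝓘(ℝ, E) z₀ →L[ℝ] TangentSpace 𝓘(ℝ, E) z₀) : Matrix ι ι ℝ :=
  let dφ : TangentSpace 𝓘(ℝ, E) z₀ →L[ℝ] (ι → ℝ) := mfderiv 𝓘(ℝ, E) 𝓘(ℝ, ι → ℝ) φ z₀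
  LinearMap.toMatrix' (dφ ∘L L ∘L dφ.inverse).toLinearMap

/-- A coupled passing of the real block matrix `(S Q; 0 P)`: a complex eigenvalue `μ` of `P`, with
eigenvector `v`, is also an eigenvalue of `S`, and the preimage `(S - μ I)⁻¹ Q v` is empty. -/
def CoupledPassing {a b : Type*} [Fintype a] [DecidableEq a] [Fintype b] [DecidableEq b]
    (S : Matrix a a ℝ) (Q : Matrix a b ℝ) (P : Matrix b b ℝ) : Prop :=
  ∃ (μ : ℂ) (v : b → ℂ),
    Module.End.HasEigenvector (Matrix.toLin' (P.map Complex.ofReal)) μ v ∧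
    Module.End.HasEigenvalue (Matrix.toLin' (S.map Complex.ofReal)) μ ∧
    {w : a → ℂ | (S.map Complex.ofReal - μ • 1).mulVec w = (Q.map Complex.ofReal).mulVec v} = ∅

/-- The linearization of `X` at `z₀`, written in block form with respect to the coordinates
`(x, z)` of the chart `φ`, exhibits a coupled passing. -/
def ExhibitsCoupledPassing [IsManifold 𝓘(ℝ, E) ∞ M] (X : (w : M) → TangentSpace 𝓘(ℝ, E) w)
    (z₀ : M) {n r : ℕ} (φ : OpenPartialHomeomorph M (DWIndex n r → ℝ)) : Prop :=
  let A := matrixInChart φ z₀ (linearization X z₀)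
  CoupledPassing A.toBlocks₁₁ A.toBlocks₁₂ A.toBlocks₂₂

/-- Lyapunov stability of the origin for the linear dynamical system `γ' = L γ`. -/
def IsStableLinearSystem {T : Type*} [AddCommGroup T] [Module ℝ T] [TopologicalSpace T]
    [ContinuousSMul ℝ T] (L : T →L[ℝ] T) : Prop :=
  ∀ U : Set T, IsOpen U → (0 : T) ∈ U → ∃ V : Set T, IsOpen V ∧ (0 : T) ∈ V ∧ V ⊆ U ∧
    ∀ γ : ℝ → T, (∀ t, HasDerivAt γ (L (γ t)) t) → γ 0 ∈ V → ∀ t > 0, γ t ∈ U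

/-- The zero `z₀` of the vector field `X` is linearly unstable: the origin is an unstable (that is,
not Lyapunov stable) equilibrium of the linear system defined by the linearization. -/
def IsLinearlyUnstable [IsManifold 𝓘(ℝ, E) ∞ M] (X : (w : M) → TangentSpace 𝓘(ℝ, E) w)
    (z₀ : M) : Prop :=
  ¬ IsStableLinearSystem (linearization X z₀)

end PoissonDynamics

end

open PoissonDynamics

/-
In the chart the linearization is block upper triangular, and its upper left block is `S = Ω * K`
with `Ω` skew-symmetric and `K` the symmetric Hessian of `H` in the coordinates `x`. So `S` and `-S`
have the same spectrum. Suppose the linear system is stable and `(μ, v)` is a coupled passing.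

If `Re μ < 0`, then `-μ` is an eigenvalue of `S`, and its eigenvector gives an exponentially growing
solution. If `Re μ ≥ 0`, boundedness of the solutions `exp (μ t) (u + t w)` forbids a Jordan chain
at `μ`, so that `S - μ` has complementary range and kernel and `Q v = (S - μ) s + k` with
`(S - μ) k = 0`. The full matrix minus `μ` maps `(-s, v)` to `(k, 0)`, which it maps to `0`; hence
`k = 0`, and `s` lies in the preimage that was supposed to be empty.
-/

namespace PoissonDynamics

section StableLinearSystem

theorem IsStableLinearSystem.exists_norm_le {T : Type*} [NormedAddCommGroup T] [NormedSpace ℝ T]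
    {L : T →L[ℝ] T} (hL : IsStableLinearSystem L) {γ : ℝ → T}
    (hγ : ∀ t, HasDerivAt γ (L (γ t)) t) : ∃ C, ∀ t > 0, ‖γ t‖ ≤ C := by
  obtain ⟨V, hV_open, hV_zero, -, hV⟩ := hL (Metric.ball 0 1) Metric.isOpen_ball (by simp)
  have hsmall : ∀ᶠ c : ℝ in 𝓝[>] 0, c • γ 0 ∈ V :=
    nhdsWithin_le_nhds <| (continuous_id.smul continuous_const).continuousAt.eventually <| by
      simpa using hV_open.mem_nhds hV_zero
  obtain ⟨c, hcV, hc : 0 < c⟩ := (hsmall.and self_mem_nhdsWithin).exists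
  refine ⟨c⁻¹, fun t ht => ?_⟩
  have hscaled : c • γ t ∈ Metric.ball (0 : T) 1 :=
    hV (c • γ) (fun s => by simpa using (hγ s).const_smul c) hcV t ht
  rw [mem_ball_zero_iff, norm_smul, Real.norm_of_nonneg hc.le] at hscaled
  rw [← one_div, le_div_iff₀' hc]
  exact hscaled.le

theorem IsStableLinearSystem.conj {T T' : Type*} [NormedAddCommGroup T] [NormedSpace ℝ T]
    [NormedAddCommGroup T'] [NormedSpace ℝ T'] {L : T →L[ℝ] T} (hL : IsStableLinearSystem L)
    (e : T ≃L[ℝ] T') : IsStableLinearSystem ((e : T →L[ℝ] T') ∘L L ∘L (e.symm : T' →L[ℝ] T)) := by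
  intro U hU hU0
  obtain ⟨V, hV_open, hV0, hVU, hV⟩ := hL (e ⁻¹' U) (hU.preimage e.continuous) (by simpa using hU0)
  refine ⟨e.symm ⁻¹' V, hV_open.preimage e.symm.continuous, by simpa using hV0,
    fun y hy => by simpa using hVU hy, fun γ hγ hγ0 t ht => ?_⟩
  have hpull : ∀ s, HasDerivAt (e.symm ∘ γ) (L (e.symm (γ s))) s := fun s => by
    simpa using e.symm.hasFDerivAt.comp_hasDerivAt s (hγ s)
  simpa using hV (e.symm ∘ γ) hpull hγ0 t ht

end StableLinearSystem

section RealMatrix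

variable {ι : Type*} [Fintype ι] [DecidableEq ι] {A : Matrix ι ι ℝ}

/-- Lyapunov stability of the origin for the linear system `x' = A x` of a real matrix `A`. -/
def IsStableMatrix (A : Matrix ι ι ℝ) : Prop :=
  IsStableLinearSystem (LinearMap.toContinuousLinearMap (Matrix.toLin' A))

theorem IsStableMatrix.exists_norm_le (hA : IsStableMatrix A) {X : ℝ → ι → ℂ}
    (hX : ∀ t, HasDerivAt X ((A.map Complex.ofReal).mulVec (X t)) t) :
    ∃ C, ∀ t > 0, ‖X t‖ ≤ C := by
  have hpart (ρ : ℂ →L[ℝ] ℝ) : ∃ C, ∀ t > 0, ‖fun i => ρ (X t i)‖ ≤ C := by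
    refine IsStableLinearSystem.exists_norm_le hA fun t => hasDerivAt_pi.2 fun i => ?_
    refine (ρ.hasFDerivAt.comp_hasDerivAt t (hasDerivAt_pi.1 (hX t) i)).congr_deriv ?_
    simp [Matrix.mulVec, dotProduct, ← Complex.real_smul]
  obtain ⟨C, hC⟩ := hpart Complex.reCLM
  obtain ⟨D, hD⟩ := hpart Complex.imCLM
  refine ⟨C + D, fun t ht => ?_⟩
  have hCD : 0 ≤ C + D :=
    add_nonneg ((norm_nonneg _).trans (hC t ht)) ((norm_nonneg _).trans (hD t ht))
  refine (pi_norm_le_iff_of_nonneg hCD).2 fun i => (Complex.norm_le_abs_re_add_abs_im _).trans ?_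
  exact add_le_add ((norm_le_pi_norm (fun i => Complex.reCLM (X t i)) i).trans (hC t ht))
    ((norm_le_pi_norm (fun i => Complex.imCLM (X t i)) i).trans (hD t ht))

end RealMatrix

section JordanChain

theorem hasDerivAt_exp_smul_add_smul {V : Type*} [NormedAddCommGroup V] [NormedSpace ℂ V]
    (f : V →ₗ[ℂ] V) {ν : ℂ} {u w : V} (hu : f u = ν • u + w) (hw : f w = ν • w) (t : ℝ) :
    HasDerivAt (fun t : ℝ => Complex.exp (ν * t) • (u + (t : ℂ) • w))
      (f (Complex.exp (ν * t) • (u + (t : ℂ) • w))) t := by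
  have hexp : HasDerivAt (fun t : ℝ => Complex.exp (ν * t)) (Complex.exp (ν * t) * ν) t := by
    simpa using ((hasDerivAt_id (t : ℂ)).const_mul ν).cexp.comp_ofReal
  have hlin : HasDerivAt (fun t : ℝ => u + (t : ℂ) • w) w t := by
    simpa using (Complex.ofRealCLM.hasDerivAt.smul_const w).const_add u
  refine (hexp.smul hlin).congr_deriv ?_
  simp only [map_smul, map_add, hu, hw]
  module

variable {V : Type*} [NormedAddCommGroup V] [NormedSpace ℂ V] {ν : ℂ} {u w : V} {C : ℝ}

theorem eq_zero_of_norm_exp_smul_add_smul_le (hν : 0 ≤ ν.re)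
    (hC : ∀ t : ℝ, 0 < t → ‖Complex.exp (ν * t) • (u + (t : ℂ) • w)‖ ≤ C) : w = 0 := by
  by_contra hw0
  have hlin : ∀ t : ℝ, 0 < t → t * ‖w‖ ≤ C + ‖u‖ := fun t ht => by
    have hexp : 1 ≤ ‖Complex.exp (ν * t)‖ := by
      rw [Complex.norm_exp, Real.one_le_exp_iff, Complex.re_mul_ofReal]
      positivity
    have hsum : ‖u + (t : ℂ) • w‖ ≤ C := by
      refine (le_mul_of_one_le_left (norm_nonneg _) hexp).trans ?_
      rw [← norm_smul]
      exact hC t ht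
    calc t * ‖w‖ = ‖(u + (t : ℂ) • w) - u‖ := by
          rw [add_sub_cancel_left, norm_smul, Complex.norm_of_nonneg ht.le]
      _ ≤ C + ‖u‖ := (norm_sub_le _ _).trans (by gcongr)
  have hlim : Filter.Tendsto (fun t : ℝ => t * ‖w‖) Filter.atTop Filter.atTop :=
    Filter.tendsto_id.atTop_mul_const (norm_pos_iff.2 hw0)
  obtain ⟨t, ht, hlarge⟩ :=
    ((Filter.eventually_gt_atTop 0).and (hlim.eventually_gt_atTop (C + ‖u‖))).exists
  exact hlarge.not_ge (hlin t ht)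

theorem eq_zero_of_norm_exp_smul_le (hν : 0 < ν.re)
    (hC : ∀ t : ℝ, 0 < t → ‖Complex.exp (ν * t) • u‖ ≤ C) : u = 0 := by
  by_contra hu0
  have hlim :
      Filter.Tendsto (fun t : ℝ => ‖Complex.exp (ν * t) • u‖) Filter.atTop Filter.atTop := by
    simp only [norm_smul, Complex.norm_exp, Complex.re_mul_ofReal]
    exact (Real.tendsto_exp_atTop.comp
      (Filter.tendsto_id.const_mul_atTop hν)).atTop_mul_const (norm_pos_iff.2 hu0)
  obtain ⟨t, ht, hlarge⟩ :=
    ((Filter.eventually_gt_atTop 0).and (hlim.eventually_gt_atTop C)).exists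
  exact hlarge.not_ge (hC t ht)

end JordanChain

section Spectrum

variable {ι : Type*} [Fintype ι] [DecidableEq ι] {A : Matrix ι ι ℝ}

theorem IsStableMatrix.disjoint_range_ker (hA : IsStableMatrix A) {ν : ℂ} (hν : 0 ≤ ν.re) :
    Disjoint (A.map Complex.ofReal - ν • 1).mulVecLin.range
      (A.map Complex.ofReal - ν • 1).mulVecLin.ker := by
  rw [Submodule.disjoint_def]
  rintro _ ⟨u, rfl⟩ hker
  set w := (A.map Complex.ofReal - ν • 1).mulVecLin u with hw_def
  have hu : (A.map Complex.ofReal).mulVecLin u = ν • u + w := by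
    rw [hw_def, Matrix.mulVecLin_apply, Matrix.mulVecLin_apply, Matrix.sub_mulVec,
      Matrix.smul_mulVec, Matrix.one_mulVec, add_sub_cancel]
  have hw : (A.map Complex.ofReal).mulVecLin w = ν • w := by
    simpa [Matrix.sub_mulVec, Matrix.smul_mulVec, sub_eq_zero] using hker
  obtain ⟨C, hC⟩ := hA.exists_norm_le (hasDerivAt_exp_smul_add_smul _ hu hw)
  exact eq_zero_of_norm_exp_smul_add_smul_le hν hC

theorem IsStableMatrix.eq_zero_of_mulVec_eq_smul (hA : IsStableMatrix A) {ν : ℂ} (hν : 0 < ν.re)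
    {u : ι → ℂ} (hu : (A.map Complex.ofReal).mulVec u = ν • u) : u = 0 := by
  obtain ⟨C, hC⟩ := hA.exists_norm_le (hasDerivAt_exp_smul_add_smul (w := 0)
    (Matrix.mulVecLin (A.map Complex.ofReal)) (by simpa using hu) (by simp))
  exact eq_zero_of_norm_exp_smul_le hν (by simpa using hC)

end Spectrum

section BlockTriangular

variable {K a b : Type*} [Field K] [Fintype a] [Fintype b]
  {S : Matrix a a K} {Q : Matrix a b K} {P : Matrix b b K}

theorem disjoint_range_ker_of_fromBlocks
    (hN : Disjoint (Matrix.fromBlocks S Q 0 P).mulVecLin.range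
      (Matrix.fromBlocks S Q 0 P).mulVecLin.ker) :
    Disjoint S.mulVecLin.range S.mulVecLin.ker := by
  rw [Submodule.disjoint_def] at hN ⊢
  rintro _ ⟨x, rfl⟩ (hx : S.mulVec (S.mulVec x) = 0)
  have hlift : Sum.elim (S.mulVec x) (0 : b → K) = 0 :=
    hN _ ⟨Sum.elim x 0, by simp [Matrix.fromBlocks_mulVec]⟩
      (by simp [Matrix.fromBlocks_mulVec, hx])
  exact funext fun i => congrFun hlift (.inl i)

theorem exists_mulVec_eq_of_disjoint_range_ker
    (hN : Disjoint (Matrix.fromBlocks S Q 0 P).mulVecLin.range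
      (Matrix.fromBlocks S Q 0 P).mulVecLin.ker) {v : b → K} (hv : P.mulVec v = 0) :
    ∃ w, S.mulVec w = Q.mulVec v := by
  have htop : S.mulVecLin.range ⊔ S.mulVecLin.ker = ⊤ :=
    Submodule.eq_top_of_disjoint _ _ S.mulVecLin.finrank_range_add_finrank_ker.ge
      (disjoint_range_ker_of_fromBlocks hN)
  obtain ⟨_, ⟨s, rfl⟩, k, hk, hsk⟩ :=
    Submodule.mem_sup.1 (htop ▸ Submodule.mem_top : Q.mulVec v ∈ _)
  have hk_range : (Matrix.fromBlocks S Q 0 P).mulVec (Sum.elim (-s) v) = Sum.elim k 0 := by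
    simp [Matrix.fromBlocks_mulVec, hv, ← hsk, Matrix.mulVec_neg]
  have hk_zero : Sum.elim k (0 : b → K) = 0 :=
    Submodule.disjoint_def.1 hN _ ⟨_, hk_range⟩ (by simp_all [Matrix.fromBlocks_mulVec])
  have : k = 0 := funext fun i => congrFun hk_zero (.inl i)
  exact ⟨s, by simpa [this] using hsk⟩

end BlockTriangular

section CoupledPassing

theorem charpoly_neg_mul_of_isSymm {ι R : Type*} [Fintype ι] [DecidableEq ι] [CommRing R]
    {Ω K : Matrix ι ι R} (hΩ : Ω.transpose = -Ω) (hK : K.IsSymm) :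
    (-(Ω * K)).charpoly = (Ω * K).charpoly := by
  rw [← Matrix.charpoly_transpose, Matrix.transpose_neg, Matrix.transpose_mul, hΩ, hK.eq,
    Matrix.mul_neg, neg_neg, Matrix.charpoly_mul_comm]

theorem exists_mulVec_eq_neg_smul_of_charpoly_neg {a : Type*} [Fintype a] [DecidableEq a]
    {S : Matrix a a ℝ} (hS : (-S).charpoly = S.charpoly) {μ : ℂ}
    (hμ : Module.End.HasEigenvalue (Matrix.toLin' (S.map Complex.ofReal)) μ) :
    ∃ u ≠ 0, (S.map Complex.ofReal).mulVec u = -μ • u := by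
  have hchar : (-S.map Complex.ofReal).charpoly = (S.map Complex.ofReal).charpoly := by
    have := congrArg (Polynomial.map Complex.ofRealHom) hS
    rw [← Matrix.charpoly_map, ← Matrix.charpoly_map, Matrix.map_neg _ (map_neg _)] at this
    exact this
  have hneg : Module.End.HasEigenvalue (Matrix.toLin' (-S.map Complex.ofReal)) μ := by
    rw [Module.End.hasEigenvalue_iff_isRoot_charpoly, Matrix.charpoly_toLin'] at hμ ⊢
    rwa [hchar]
  obtain ⟨u, hu⟩ := hneg.exists_hasEigenvector
  refine ⟨u, hu.2, ?_⟩
  have hu_eq := hu.apply_eq_smul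
  rw [Matrix.toLin'_apply, Matrix.neg_mulVec] at hu_eq
  rw [neg_smul, ← hu_eq, neg_neg]

variable {a b : Type*} [Fintype a] [DecidableEq a] [Fintype b] [DecidableEq b]
  {S : Matrix a a ℝ} {Q : Matrix a b ℝ} {P : Matrix b b ℝ}

theorem IsStableMatrix.not_coupledPassing (hA : IsStableMatrix (Matrix.fromBlocks S Q 0 P))
    (hS : (-S).charpoly = S.charpoly) : ¬ CoupledPassing S Q P := by
  rintro ⟨μ, v, hv, hμ, hempty⟩
  have hA_map : (Matrix.fromBlocks S Q 0 P).map Complex.ofReal = Matrix.fromBlocks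
      (S.map Complex.ofReal) (Q.map Complex.ofReal) 0 (P.map Complex.ofReal) := by
    simp [Matrix.fromBlocks_map]
  rcases lt_or_ge μ.re 0 with hμ_neg | hμ_nonneg
  · obtain ⟨u, hu_ne, hu⟩ := exists_mulVec_eq_neg_smul_of_charpoly_neg hS hμ
    have hlift : Sum.elim u (0 : b → ℂ) = 0 :=
      hA.eq_zero_of_mulVec_eq_smul (ν := -μ) (by simpa using hμ_neg) <| by
        rw [hA_map, Matrix.fromBlocks_mulVec]
        ext (i | k) <;> simp [hu]
    exact hu_ne (funext fun i => congrFun hlift (.inl i))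
  · have hdisj := hA.disjoint_range_ker hμ_nonneg
    rw [hA_map, ← Matrix.fromBlocks_one, Matrix.fromBlocks_smul, sub_eq_add_neg,
      Matrix.fromBlocks_neg, Matrix.fromBlocks_add, smul_zero, smul_zero, neg_zero, neg_zero,
      add_zero, add_zero, ← sub_eq_add_neg, ← sub_eq_add_neg] at hdisj
    have hv_ker : (P.map Complex.ofReal - μ • 1).mulVec v = 0 := by
      simpa [Matrix.sub_mulVec, Matrix.smul_mulVec, sub_eq_zero] using hv.apply_eq_smul
    obtain ⟨w, hw⟩ := exists_mulVec_eq_of_disjoint_range_ker hdisj hv_ker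
    exact (hempty ▸ hw : w ∈ (∅ : Set (a → ℂ)))

end CoupledPassing

section ChartRepresentative

theorem hasFDerivAt_fderiv_apply_of_eq_zero {E F : Type*} [NormedAddCommGroup E]
    [NormedSpace ℝ E] [NormedAddCommGroup F] [NormedSpace ℝ F] {g : F → E} {Y : F → F} {y : F}
    (hg : ContDiffAt ℝ 2 g y) (hY : DifferentiableAt ℝ Y y) (hY_zero : Y y = 0) :
    HasFDerivAt (fun x => fderiv ℝ g x (Y x)) (fderiv ℝ g y ∘L fderiv ℝ Y y) y := by
  have hdg : DifferentiableAt ℝ (fderiv ℝ g) y :=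
    (hg.fderiv_right (m := 1) one_add_one_eq_two.le).differentiableAt one_ne_zero
  refine (hdg.hasFDerivAt.clm_apply hY.hasFDerivAt).congr_fderiv ?_
  rw [hY_zero, map_zero, add_zero]

variable {E F : Type*} [NormedAddCommGroup E] [NormedSpace ℝ E] [NormedAddCommGroup F]
  [NormedSpace ℝ F] {M : Type*} [TopologicalSpace M] [ChartedSpace E M]

/-- The vector field `X` read in the chart `φ`: its push-forward to the model space `F`, meaningful
on `φ.target`. -/
noncomputable def chartRepresentative (φ : OpenPartialHomeomorph M F)
    (X : (w : M) → TangentSpace 𝓘(ℝ, E) w) (y : F) : F :=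
  mfderiv 𝓘(ℝ, E) 𝓘(ℝ, F) φ (φ.symm y) (X (φ.symm y))

variable {φ : OpenPartialHomeomorph M F} {X : (w : M) → TangentSpace 𝓘(ℝ, E) w} {z₀ w : M}

theorem chartRepresentative_apply (hw : w ∈ φ.source) :
    chartRepresentative φ X (φ w) = mfderiv 𝓘(ℝ, E) 𝓘(ℝ, F) φ w (X w) := by
  rw [chartRepresentative, φ.left_inv hw]

theorem chartRepresentative_eq_zero (hw : w ∈ φ.source) (hX : X w = 0) :
    chartRepresentative φ X (φ w) = 0 := by
  rw [chartRepresentative_apply hw, hX]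
  exact map_zero _

variable [IsManifold 𝓘(ℝ, E) ∞ M]

theorem fderiv_extChartAt_comp_symm_mfderiv (hφ : φ.MDifferentiable 𝓘(ℝ, E) 𝓘(ℝ, F))
    (hw : w ∈ φ.source) (hw_chart : w ∈ (chartAt E z₀).source) (v : TangentSpace 𝓘(ℝ, E) w) :
    fderiv ℝ (extChartAt 𝓘(ℝ, E) z₀ ∘ φ.symm) (φ w) (mfderiv 𝓘(ℝ, E) 𝓘(ℝ, F) φ w v) =
      mfderiv 𝓘(ℝ, E) 𝓘(ℝ, E) (extChartAt 𝓘(ℝ, E) z₀) w v := by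
  have : IsManifold 𝓘(ℝ, E) 1 M := IsManifold.of_le (n := ∞) (by simp)
  have hchart : HasMFDerivAt 𝓘(ℝ, E) 𝓘(ℝ, E) (extChartAt 𝓘(ℝ, E) z₀) (φ.symm (φ w))
      (mfderiv 𝓘(ℝ, E) 𝓘(ℝ, E) (extChartAt 𝓘(ℝ, E) z₀) w) := by
    rw [φ.left_inv hw]
    exact (mdifferentiableAt_extChartAt hw_chart).hasMFDerivAt
  have hcomp := hchart.comp (φ w) (hφ.mdifferentiableAt_symm (φ.map_source hw)).hasMFDerivAt
  rw [← mfderiv_eq_fderiv, hcomp.mfderiv]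
  exact congrArg (mfderiv 𝓘(ℝ, E) 𝓘(ℝ, E) (extChartAt 𝓘(ℝ, E) z₀) w)
    (DFunLike.congr_fun (hφ.symm_comp_deriv hw) v)

theorem trivializationAt_snd_eq_fderiv_chartRepresentative
    (hφ : φ.MDifferentiable 𝓘(ℝ, E) 𝓘(ℝ, F)) (hw : w ∈ φ.source)
    (hw_chart : w ∈ (chartAt E z₀).source) :
    (trivializationAt E (TangentSpace 𝓘(ℝ, E)) z₀ ⟨w, X w⟩).2 =
      fderiv ℝ (extChartAt 𝓘(ℝ, E) z₀ ∘ φ.symm) (φ w) (chartRepresentative φ X (φ w)) := by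
  rw [chartRepresentative_apply hw, fderiv_extChartAt_comp_symm_mfderiv hφ hw hw_chart,
    ← TangentBundle.continuousLinearMapAt_trivializationAt hw_chart]
  exact (congrFun ((trivializationAt E (TangentSpace 𝓘(ℝ, E)) z₀).coe_linearMapAt_of_mem
    (R := ℝ) hw_chart) (X w)).symm

theorem linearization_apply_eq_fderiv_chartRepresentative
    (hφ : φ.MDifferentiable 𝓘(ℝ, E) 𝓘(ℝ, F))
    (hφ_symm : ContMDiffAt 𝓘(ℝ, F) 𝓘(ℝ, E) 2 φ.symm (φ z₀)) (hz₀ : z₀ ∈ φ.source)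
    (hX : X z₀ = 0) (hY : DifferentiableAt ℝ (chartRepresentative φ X) (φ z₀))
    (v : TangentSpace 𝓘(ℝ, E) z₀) :
    linearization X z₀ v = fderiv ℝ (extChartAt 𝓘(ℝ, E) z₀ ∘ φ.symm) (φ z₀)
      (fderiv ℝ (chartRepresentative φ X) (φ z₀) (mfderiv 𝓘(ℝ, E) 𝓘(ℝ, F) φ z₀ v)) := by
  set g := extChartAt 𝓘(ℝ, E) z₀ ∘ φ.symm
  have hlocal : (fun w => (trivializationAt E (TangentSpace 𝓘(ℝ, E)) z₀ ⟨w, X w⟩).2) =ᶠ[𝓝 z₀]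
      (fun y => fderiv ℝ g y (chartRepresentative φ X y)) ∘ φ := by
    filter_upwards [φ.open_source.mem_nhds hz₀, chart_source_mem_nhds E z₀] with w hw hw_chart
    exact trivializationAt_snd_eq_fderiv_chartRepresentative hφ hw hw_chart
  have hg : ContDiffAt ℝ 2 g (φ z₀) := by
    refine (ContMDiffAt.comp (φ z₀) ?_ hφ_symm).contDiffAt
    rw [φ.left_inv hz₀]
    exact contMDiffAt_extChartAt.of_le (WithTop.coe_le_coe.2 le_top)
  have hderiv := (hasFDerivAt_fderiv_apply_of_eq_zero hg hY
    (chartRepresentative_eq_zero hz₀ hX)).hasMFDerivAt.comp z₀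
      (hφ.mdifferentiableAt hz₀).hasMFDerivAt
  exact DFunLike.congr_fun (hlocal.mfderiv_eq.trans hderiv.mfderiv) v

theorem mfderiv_linearization (hφ : φ.MDifferentiable 𝓘(ℝ, E) 𝓘(ℝ, F))
    (hφ_symm : ContMDiffAt 𝓘(ℝ, F) 𝓘(ℝ, E) 2 φ.symm (φ z₀)) (hz₀ : z₀ ∈ φ.source)
    (hX : X z₀ = 0) (hY : DifferentiableAt ℝ (chartRepresentative φ X) (φ z₀))
    (v : TangentSpace 𝓘(ℝ, E) z₀) :
    mfderiv 𝓘(ℝ, E) 𝓘(ℝ, F) φ z₀ (linearization X z₀ v) =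
      fderiv ℝ (chartRepresentative φ X) (φ z₀) (mfderiv 𝓘(ℝ, E) 𝓘(ℝ, F) φ z₀ v) := by
  obtain ⟨u, hu⟩ := hφ.mfderiv_surjective hz₀
    (fderiv ℝ (chartRepresentative φ X) (φ z₀) (mfderiv 𝓘(ℝ, E) 𝓘(ℝ, F) φ z₀ v))
  have hlin : linearization X z₀ v = u := by
    rw [linearization_apply_eq_fderiv_chartRepresentative hφ hφ_symm hz₀ hX hY, ← hu,
      fderiv_extChartAt_comp_symm_mfderiv hφ hz₀ (mem_chart_source E z₀), mfderiv_extChartAt_self]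
    rfl
  rw [hlin, hu]

end ChartRepresentative

section MatrixInChart

variable {E ι : Type*} [NormedAddCommGroup E] [NormedSpace ℝ E] [Fintype ι] [DecidableEq ι]
  {M : Type*} [TopologicalSpace M] [ChartedSpace E M] {φ : OpenPartialHomeomorph M (ι → ℝ)}
  {z₀ : M}

theorem matrixInChart_eq_toMatrix' (hφ : φ.MDifferentiable 𝓘(ℝ, E) 𝓘(ℝ, ι → ℝ))
    (hz₀ : z₀ ∈ φ.source) (L : TangentSpace 𝓘(ℝ, E) z₀ →L[ℝ] TangentSpace 𝓘(ℝ, E) z₀)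
    {A : (ι → ℝ) →ₗ[ℝ] ι → ℝ}
    (hA : ∀ v, mfderiv 𝓘(ℝ, E) 𝓘(ℝ, ι → ℝ) φ z₀ (L v) = A (mfderiv 𝓘(ℝ, E) 𝓘(ℝ, ι → ℝ) φ z₀ v)) :
    matrixInChart φ z₀ L = LinearMap.toMatrix' A := by
  refine congrArg LinearMap.toMatrix' (LinearMap.ext fun y => (hA _).trans (congrArg A ?_))
  let e : E ≃L[ℝ] (ι → ℝ) := hφ.mfderiv hz₀
  have hinv : (e : E →L[ℝ] (ι → ℝ)).inverse = e.symm := ContinuousLinearMap.inverse_equiv e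
  exact (congrArg e (DFunLike.congr_fun hinv y)).trans (e.apply_symm_apply y)

theorem IsStableLinearSystem.isStableMatrix_matrixInChart
    (hφ : φ.MDifferentiable 𝓘(ℝ, E) 𝓘(ℝ, ι → ℝ)) (hz₀ : z₀ ∈ φ.source)
    {L : TangentSpace 𝓘(ℝ, E) z₀ →L[ℝ] TangentSpace 𝓘(ℝ, E) z₀} (hL : IsStableLinearSystem L) :
    IsStableMatrix (matrixInChart φ z₀ L) := by
  let e : E ≃L[ℝ] (ι → ℝ) := hφ.mfderiv hz₀
  have hconj := IsStableLinearSystem.conj (T := E) (L := L) hL e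
  have hmat := matrixInChart_eq_toMatrix' hφ hz₀ L
    (A := (e : E →L[ℝ] (ι → ℝ)) ∘L (L : E →L[ℝ] E) ∘L (e.symm : (ι → ℝ) →L[ℝ] E)) fun v =>
      congrArg (fun u => e (L u)) (e.symm_apply_apply v).symm
  rw [IsStableMatrix, hmat, Matrix.toLin'_toMatrix']
  exact hconj

variable [IsManifold 𝓘(ℝ, E) ∞ M] {X : (w : M) → TangentSpace 𝓘(ℝ, E) w}

theorem matrixInChart_linearization (hφ : φ.MDifferentiable 𝓘(ℝ, E) 𝓘(ℝ, ι → ℝ))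
    (hφ_symm : ContMDiffAt 𝓘(ℝ, ι → ℝ) 𝓘(ℝ, E) 2 φ.symm (φ z₀)) (hz₀ : z₀ ∈ φ.source)
    (hX : X z₀ = 0) (hY : DifferentiableAt ℝ (chartRepresentative φ X) (φ z₀)) :
    matrixInChart φ z₀ (linearization X z₀) =
      LinearMap.toMatrix' (fderiv ℝ (chartRepresentative φ X) (φ z₀)).toLinearMap :=
  matrixInChart_eq_toMatrix' hφ hz₀ _ (mfderiv_linearization hφ hφ_symm hz₀ hX hY)

end MatrixInChart

section CoordinateDerivatives

variable {ι : Type*} [Fintype ι] [DecidableEq ι]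

/-- The vector of partial derivatives of `h` at `y`. -/
noncomputable def coordGradient (h : (ι → ℝ) → ℝ) (y : ι → ℝ) : ι → ℝ :=
  fun i => fderiv ℝ h y (Pi.single i 1)

/-- The matrix of second partial derivatives of `h` at `y`; its entry `i j` is `∂ⱼ ∂ᵢ h`. -/
noncomputable def coordHessian (h : (ι → ℝ) → ℝ) (y : ι → ℝ) : Matrix ι ι ℝ :=
  Matrix.of fun i j => fderiv ℝ (fun x => coordGradient h x i) y (Pi.single j 1)

theorem fderiv_apply_eq_dotProduct_coordGradient (h : (ι → ℝ) → ℝ) (y v : ι → ℝ) :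
    fderiv ℝ h y v = v ⬝ᵥ coordGradient h y := by
  conv_lhs => rw [pi_eq_sum_univ' v, map_sum]
  simp only [map_smul, smul_eq_mul, dotProduct, coordGradient]

variable {h : (ι → ℝ) → ℝ} {y : ι → ℝ}

theorem differentiableAt_coordGradient (hh : ContDiffAt ℝ 2 h y) (i : ι) :
    DifferentiableAt ℝ (fun x => coordGradient h x i) y :=
  ((hh.fderiv_right (m := 1) one_add_one_eq_two.le).differentiableAt one_ne_zero).clm_apply
    (differentiableAt_const _)

theorem isSymm_coordHessian (hh : ContDiffAt ℝ 2 h y) : (coordHessian h y).IsSymm := by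
  have hdiff : DifferentiableAt ℝ (fderiv ℝ h) y :=
    (hh.fderiv_right (m := 1) one_add_one_eq_two.le).differentiableAt one_ne_zero
  have hentry (i j : ι) : coordHessian h y i j =
      fderiv ℝ (fderiv ℝ h) y (Pi.single j 1) (Pi.single i 1) := by
    simp [coordHessian, coordGradient, fderiv_clm_apply hdiff (differentiableAt_const _)]
  ext i j
  rw [Matrix.transpose_apply, hentry, hentry]
  exact hh.isSymmSndFDerivAt (by simp) _ _

theorem toMatrix'_fderiv_apply {Y : (ι → ℝ) → ι → ℝ} (hY : DifferentiableAt ℝ Y y) (i j : ι) :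
    LinearMap.toMatrix' (fderiv ℝ Y y).toLinearMap i j =
      fderiv ℝ (fun x => Y x i) y (Pi.single j 1) := by
  rw [LinearMap.toMatrix'_apply, fderiv_apply hY i]
  simp

variable {a b : Type*} [Fintype a] [DecidableEq a] [Fintype b] [DecidableEq b]
  {f : (a ⊕ b → ℝ) → ℝ} {Y : (a ⊕ b → ℝ) → a ⊕ b → ℝ} {x : a ⊕ b → ℝ}

theorem toBlocks₁₁_toMatrix'_fderiv_of_eq_mul_coordGradient {Ω : Matrix a a ℝ}
    (hf : ContDiffAt ℝ 2 f x) (hY : DifferentiableAt ℝ Y x)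
    (hYΩ : ∀ᶠ y in 𝓝 x, ∀ i, Y y (.inl i) = ∑ j, Ω i j * coordGradient f y (.inl j)) :
    (LinearMap.toMatrix' (fderiv ℝ Y x).toLinearMap).toBlocks₁₁ =
      Ω * (coordHessian f x).toBlocks₁₁ := by
  ext i k
  have hi : (fun y => Y y (.inl i)) =ᶠ[𝓝 x] fun y => ∑ j, Ω i j * coordGradient f y (.inl j) :=
    hYΩ.mono fun y hy => hy i
  have hsum : HasFDerivAt (fun y => ∑ j, Ω i j * coordGradient f y (.inl j))
      (∑ j, Ω i j • fderiv ℝ (fun y => coordGradient f y (.inl j)) x) x :=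
    HasFDerivAt.fun_sum fun j _ => (differentiableAt_coordGradient hf _).hasFDerivAt.const_mul _
  simp only [Matrix.toBlocks₁₁, Matrix.of_apply, toMatrix'_fderiv_apply hY, hi.fderiv_eq,
    hsum.fderiv, Matrix.mul_apply, coordHessian, sum_apply, smul_apply, smul_eq_mul]

theorem toBlocks₂₁_toMatrix'_fderiv_eq_zero (hY : DifferentiableAt ℝ Y x)
    (hY_zero : ∀ᶠ y in 𝓝 x, y ∘ .inr = x ∘ .inr → Y y ∘ .inr = 0) :
    (LinearMap.toMatrix' (fderiv ℝ Y x).toLinearMap).toBlocks₂₁ = 0 := by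
  ext k i
  have hline := (differentiableAt_pi.1 hY (.inr k)).hasFDerivAt.hasLineDerivAt
    (Pi.single (.inl i) 1)
  have hlim : Filter.Tendsto (fun t : ℝ => x + t • Pi.single (.inl i) 1) (𝓝 0) (𝓝 x) := by
    have : Continuous fun t : ℝ => x + t • (Pi.single (.inl i) 1 : a ⊕ b → ℝ) := by fun_prop
    simpa using this.tendsto 0
  have hvanish : (fun t : ℝ => Y (x + t • Pi.single (.inl i) 1) (.inr k)) =ᶠ[𝓝 0] fun _ => 0 := by
    filter_upwards [hlim.eventually hY_zero] with t ht
    exact congrFun (ht (funext fun l => by simp)) k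
  rw [Matrix.toBlocks₂₁, Matrix.of_apply, toMatrix'_fderiv_apply hY]
  exact HasDerivAt.unique hline
    ((hasDerivAt_const (0 : ℝ) (0 : ℝ)).congr_of_eventuallyEq hvanish)

end CoordinateDerivatives

section ChartCoordinates

variable {E ι : Type*} [NormedAddCommGroup E] [NormedSpace ℝ E] [Fintype ι]
  {M : Type*} [TopologicalSpace M] [ChartedSpace E M]

theorem mfderiv_apply_eq_of_eventuallyEq {f : M → ι → ℝ} {w : M}
    (hf : MDifferentiableAt 𝓘(ℝ, E) 𝓘(ℝ, ι → ℝ) f w) {i : ι} {F : M → ℝ}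
    (hF : F =ᶠ[𝓝 w] fun y => f y i) (v : TangentSpace 𝓘(ℝ, E) w) :
    (mfderiv 𝓘(ℝ, E) 𝓘(ℝ, ι → ℝ) f w v : ι → ℝ) i = mfderiv 𝓘(ℝ, E) 𝓘(ℝ, ℝ) F w v := by
  have hproj := (ContinuousLinearMap.proj (R := ℝ) (φ := fun _ : ι => ℝ) i).hasFDerivAt
    (x := f w) |>.hasMFDerivAt.comp w hf.hasMFDerivAt
  exact (DFunLike.congr_fun (hF.mfderiv_eq.trans hproj.mfderiv) v).symm

theorem mfderiv_eq_dotProduct_coordGradient [DecidableEq ι]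
    {φ : OpenPartialHomeomorph M (ι → ℝ)} (hφ : φ.MDifferentiable 𝓘(ℝ, E) 𝓘(ℝ, ι → ℝ)) {w : M}
    (hw : w ∈ φ.source) {H : M → ℝ} (hH : MDifferentiableAt 𝓘(ℝ, E) 𝓘(ℝ, ℝ) H w)
    (v : TangentSpace 𝓘(ℝ, E) w) :
    (mfderiv 𝓘(ℝ, E) 𝓘(ℝ, ℝ) H w v : ℝ) =
      mfderiv 𝓘(ℝ, E) 𝓘(ℝ, ι → ℝ) φ w v ⬝ᵥ coordGradient (H ∘ φ.symm) (φ w) := by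
  have hH_symm : MDifferentiableAt 𝓘(ℝ, ι → ℝ) 𝓘(ℝ, ℝ) (H ∘ φ.symm) (φ w) := by
    refine MDifferentiableAt.comp (φ w) ?_ (hφ.mdifferentiableAt_symm (φ.map_source hw))
    rwa [φ.left_inv hw]
  have hlocal : H =ᶠ[𝓝 w] (H ∘ φ.symm) ∘ φ := by
    filter_upwards [φ.open_source.mem_nhds hw] with y hy
    rw [Function.comp_apply, Function.comp_apply, φ.left_inv hy]
  have hcomp := hH_symm.differentiableAt.hasFDerivAt.hasMFDerivAt.comp w
    (hφ.mdifferentiableAt hw).hasMFDerivAt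
  exact (DFunLike.congr_fun (hlocal.mfderiv_eq.trans hcomp.mfderiv) v).trans
    (fderiv_apply_eq_dotProduct_coordGradient _ _ _)

end ChartCoordinates

section LocalBracket

variable {E : Type*} [NormedAddCommGroup E] [NormedSpace ℝ E]
  {M : Type*} [TopologicalSpace M] [ChartedSpace E M] {B : PoissonStructure E M} {f g : M → ℝ}
  {w : M} {c d : ℝ}

theorem PoissonStructure.bracket_apply_skew (B : PoissonStructure E M)
    (F G : C^∞⟮𝓘(ℝ, E), M; ℝ⟯) (w : M) : B.bracket F G w = -B.bracket G F w := by
  rw [B.skew F G]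
  rfl

theorem PoissonStructure.HasLocalBracket.swap (h : B.HasLocalBracket f g w c) :
    B.HasLocalBracket g f w (-c) := by
  obtain ⟨F, G, hF, hG, rfl⟩ := h
  exact ⟨G, F, hG, hF, B.bracket_apply_skew G F w⟩

variable [FiniteDimensional ℝ E] [T2Space M] [IsManifold 𝓘(ℝ, E) ∞ M]

theorem PoissonStructure.bracket_congr_left (B : PoissonStructure E M)
    {F F' : C^∞⟮𝓘(ℝ, E), M; ℝ⟯} (G : C^∞⟮𝓘(ℝ, E), M; ℝ⟯) (h : F =ᶠ[𝓝 w] F') :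
    B.bracket F G w = B.bracket F' G w := by
  rw [← B.mfderiv_hamiltonianVectorField, ← B.mfderiv_hamiltonianVectorField, h.mfderiv_eq]
  rfl

theorem PoissonStructure.HasLocalBracket.bracket_eq (h : B.HasLocalBracket f g w c)
    {F G : C^∞⟮𝓘(ℝ, E), M; ℝ⟯} (hF : F =ᶠ[𝓝 w] f) (hG : G =ᶠ[𝓝 w] g) :
    B.bracket F G w = c := by
  obtain ⟨F', G', hF', hG', rfl⟩ := h
  rw [B.bracket_congr_left G (hF.trans hF'.symm), B.bracket_apply_skew,
    B.bracket_congr_left F' (hG.trans hG'.symm), ← B.bracket_apply_skew]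

theorem PoissonStructure.HasLocalBracket.unique (hc : B.HasLocalBracket f g w c)
    (hd : B.HasLocalBracket f g w d) : c = d := by
  obtain ⟨F, G, hF, hG, rfl⟩ := hc
  exact hd.bracket_eq hF hG

end LocalBracket

section HamiltonianVectorFieldInChart

variable {E ι : Type*} [NormedAddCommGroup E] [NormedSpace ℝ E] [FiniteDimensional ℝ E]
  [Fintype ι] {M : Type*} [TopologicalSpace M] [T2Space M] [ChartedSpace E M]
  [IsManifold 𝓘(ℝ, E) ∞ M] {B : PoissonStructure E M} {φ : OpenPartialHomeomorph M (ι → ℝ)}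
  {w : M}

theorem chartRepresentative_hamiltonianVectorField_apply
    (hφ : φ.MDifferentiable 𝓘(ℝ, E) 𝓘(ℝ, ι → ℝ)) (hw : w ∈ φ.source)
    {F : C^∞⟮𝓘(ℝ, E), M; ℝ⟯} {i : ι} (hF : F =ᶠ[𝓝 w] fun y => φ y i) (H : C^∞⟮𝓘(ℝ, E), M; ℝ⟯) :
    chartRepresentative φ (B.hamiltonianVectorField H) (φ w) i = B.bracket F H w := by
  rw [chartRepresentative_apply hw, ← B.mfderiv_hamiltonianVectorField]
  exact mfderiv_apply_eq_of_eventuallyEq (hφ.mdifferentiableAt hw) hF _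

theorem differentiableAt_chartRepresentative_hamiltonianVectorField
    (hφ : φ.MDifferentiable 𝓘(ℝ, E) 𝓘(ℝ, ι → ℝ)) (hw : w ∈ φ.source)
    (hext : ∀ i, ∃ F : C^∞⟮𝓘(ℝ, E), M; ℝ⟯, F =ᶠ[𝓝 w] fun y => φ y i)
    (H : C^∞⟮𝓘(ℝ, E), M; ℝ⟯) :
    DifferentiableAt ℝ (chartRepresentative φ (B.hamiltonianVectorField H)) (φ w) := by
  refine differentiableAt_pi.2 fun i => ?_
  obtain ⟨F, hF⟩ := hext i
  have hbracket : DifferentiableAt ℝ (B.bracket F H ∘ φ.symm) (φ w) :=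
    (((B.bracket F H).contMDiff.mdifferentiable (by simp) _).comp (φ w)
      (hφ.mdifferentiableAt_symm (φ.map_source hw))).differentiableAt
  refine hbracket.congr_of_eventuallyEq ?_
  have hsymm : ∀ᶠ y in 𝓝 (φ w), F =ᶠ[𝓝 (φ.symm y)] fun y => φ y i :=
    (φ.continuousAt_symm (φ.map_source hw)).eventually
      ((φ.left_inv hw).symm ▸ hF.eventuallyEq_nhds)
  filter_upwards [φ.open_target.mem_nhds (φ.map_source hw), hsymm] with y hy hFy
  have happly :=
    chartRepresentative_hamiltonianVectorField_apply (B := B) hφ (φ.map_target hy) hFy H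
  rwa [φ.right_inv hy] at happly

theorem chartRepresentative_hamiltonianVectorField_eq_mulVec [DecidableEq ι]
    (hφ : φ.MDifferentiable 𝓘(ℝ, E) 𝓘(ℝ, ι → ℝ)) (hw : w ∈ φ.source) {C : Matrix ι ι ℝ}
    (hC : ∀ i j, B.HasLocalBracket (fun y => φ y i) (fun y => φ y j) w (C i j))
    (H : C^∞⟮𝓘(ℝ, E), M; ℝ⟯) :
    chartRepresentative φ (B.hamiltonianVectorField H) (φ w) =
      C.mulVec (coordGradient (H ∘ φ.symm) (φ w)) := by
  choose F _ hF _ _ using fun i => hC i i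
  funext i
  have hcoord : mfderiv 𝓘(ℝ, E) 𝓘(ℝ, ι → ℝ) φ w (B.hamiltonianVectorField (F i) w) = -C i := by
    funext j
    rw [← chartRepresentative_apply hw,
      chartRepresentative_hamiltonianVectorField_apply hφ hw (hF j)]
    exact (hC i j).swap.bracket_eq (hF j) (hF i)
  rw [chartRepresentative_hamiltonianVectorField_apply hφ hw (hF i), B.bracket_apply_skew,
    ← B.mfderiv_hamiltonianVectorField, mfderiv_eq_dotProduct_coordGradient hφ hw
      (H.contMDiff.mdifferentiable (by simp) w), hcoord, neg_dotProduct, neg_neg]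
  rfl

end HamiltonianVectorFieldInChart

section SplitChart

variable {E : Type*} [NormedAddCommGroup E] [NormedSpace ℝ E]
  {M : Type*} [TopologicalSpace M] [ChartedSpace E M]

/-- A smooth chart `φ = (x, z)` around `z₀` that splits the bracket: `{xⁱ, xʲ}` is the constant
`Ω i j`, possibly degenerate, `{xⁱ, zᵏ} = 0`, and `{zᵏ, zˡ} = R z k l` depends on `z` only and
vanishes at `z₀`. Darboux-Weinstein charts are those with the canonical symplectic `Ω`. -/
structure PoissonStructure.IsSplitChart (B : PoissonStructure E M) {a b : Type*} [Fintype a]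
    [Fintype b] (φ : OpenPartialHomeomorph M (a ⊕ b → ℝ)) (z₀ : M) (Ω : Matrix a a ℝ)
    (R : (b → ℝ) → Matrix b b ℝ) : Prop where
  mem_source : z₀ ∈ φ.source
  contMDiffOn : ContMDiffOn 𝓘(ℝ, E) 𝓘(ℝ, a ⊕ b → ℝ) ∞ φ φ.source
  contMDiffOn_symm : ContMDiffOn 𝓘(ℝ, a ⊕ b → ℝ) 𝓘(ℝ, E) ∞ φ.symm φ.target
  map_point : R (φ z₀ ∘ .inr) = 0
  hasLocalBracket : ∀ w ∈ φ.source, ∀ i j, B.HasLocalBracket (fun y => φ y i) (fun y => φ y j) w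
    (Matrix.fromBlocks Ω 0 0 (R (φ w ∘ .inr)) i j)

theorem PoissonStructure.IsDarbouxWeinsteinChart.exists_isSplitChart {B : PoissonStructure E M}
    {n r : ℕ} {φ : OpenPartialHomeomorph M (DWIndex n r → ℝ)} {z₀ : M}
    (hφ : B.IsDarbouxWeinsteinChart φ z₀) :
    ∃ R, B.IsSplitChart φ z₀ (-Matrix.J (Fin n) ℝ) R := by
  obtain ⟨R, hR_zero, hR⟩ := hφ.bracket_zz
  refine ⟨R, hφ.mem_source, hφ.contMDiffOn, hφ.contMDiffOn_symm, ?_, ?_⟩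
  · rw [hφ.map_point]
    exact hR_zero
  rintro w hw ((i | i) | k) ((j | j) | l)
  · simpa [Matrix.J] using hφ.bracket_qq w hw i j
  · simpa [Matrix.J, Matrix.one_apply] using hφ.bracket_qp w hw i j
  · exact hφ.bracket_qz w hw i l
  · simpa [Matrix.J, Matrix.one_apply, eq_comm, apply_ite] using (hφ.bracket_qp w hw j i).swap
  · simpa [Matrix.J] using hφ.bracket_pp w hw i j
  · exact hφ.bracket_pz w hw i l
  · simpa using (hφ.bracket_qz w hw j k).swap
  · simpa using (hφ.bracket_pz w hw j k).swap
  · exact hR w hw k l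

namespace PoissonStructure.IsSplitChart

variable {B : PoissonStructure E M} {a b : Type*} [Fintype a] [Fintype b]
  {φ : OpenPartialHomeomorph M (a ⊕ b → ℝ)} {z₀ : M} {Ω : Matrix a a ℝ}
  {R : (b → ℝ) → Matrix b b ℝ}

theorem mdifferentiable (hφ : B.IsSplitChart φ z₀ Ω R) :
    φ.MDifferentiable 𝓘(ℝ, E) 𝓘(ℝ, a ⊕ b → ℝ) :=
  ⟨hφ.contMDiffOn.mdifferentiableOn (by simp), hφ.contMDiffOn_symm.mdifferentiableOn (by simp)⟩

theorem contMDiffAt_symm (hφ : B.IsSplitChart φ z₀ Ω R) :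
    ContMDiffAt 𝓘(ℝ, a ⊕ b → ℝ) 𝓘(ℝ, E) 2 φ.symm (φ z₀) :=
  (hφ.contMDiffOn_symm.contMDiffAt (φ.open_target.mem_nhds (φ.map_source hφ.mem_source))).of_le
    (WithTop.coe_le_coe.2 le_top)

theorem contDiffAt_comp_symm (hφ : B.IsSplitChart φ z₀ Ω R) (H : C^∞⟮𝓘(ℝ, E), M; ℝ⟯) :
    ContDiffAt ℝ 2 (H ∘ φ.symm) (φ z₀) :=
  ((H.contMDiff.of_le (WithTop.coe_le_coe.2 le_top) _).comp (φ z₀)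
    hφ.contMDiffAt_symm).contDiffAt

theorem exists_extension (hφ : B.IsSplitChart φ z₀ Ω R) (i : a ⊕ b) :
    ∃ F : C^∞⟮𝓘(ℝ, E), M; ℝ⟯, F =ᶠ[𝓝 z₀] fun y => φ y i :=
  let ⟨F, _, hF, _⟩ := hφ.hasLocalBracket z₀ hφ.mem_source i i
  ⟨F, hF⟩

variable [FiniteDimensional ℝ E] [T2Space M] [IsManifold 𝓘(ℝ, E) ∞ M]

theorem transpose_eq_neg (hφ : B.IsSplitChart φ z₀ Ω R) : Ω.transpose = -Ω := by
  ext i j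
  exact (hφ.hasLocalBracket z₀ hφ.mem_source (.inl j) (.inl i)).unique
    (hφ.hasLocalBracket z₀ hφ.mem_source (.inl i) (.inl j)).swap

theorem differentiableAt_chartRepresentative (hφ : B.IsSplitChart φ z₀ Ω R)
    (H : C^∞⟮𝓘(ℝ, E), M; ℝ⟯) :
    DifferentiableAt ℝ (chartRepresentative φ (B.hamiltonianVectorField H)) (φ z₀) :=
  differentiableAt_chartRepresentative_hamiltonianVectorField hφ.mdifferentiable hφ.mem_source
    hφ.exists_extension H

variable [DecidableEq a] [DecidableEq b]

theorem chartRepresentative_eq_mulVec (hφ : B.IsSplitChart φ z₀ Ω R) (H : C^∞⟮𝓘(ℝ, E), M; ℝ⟯)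
    {y : a ⊕ b → ℝ} (hy : y ∈ φ.target) :
    chartRepresentative φ (B.hamiltonianVectorField H) y =
      (Matrix.fromBlocks Ω 0 0 (R (y ∘ .inr))).mulVec (coordGradient (H ∘ φ.symm) y) := by
  have hbracket := hφ.hasLocalBracket (φ.symm y) (φ.map_target hy)
  rw [φ.right_inv hy] at hbracket
  simpa only [φ.right_inv hy] using chartRepresentative_hamiltonianVectorField_eq_mulVec
    hφ.mdifferentiable (φ.map_target hy) hbracket H

theorem matrixInChart_linearization_eq_toMatrix' (hφ : B.IsSplitChart φ z₀ Ω R)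
    {H : C^∞⟮𝓘(ℝ, E), M; ℝ⟯} (hH : B.hamiltonianVectorField H z₀ = 0) :
    matrixInChart φ z₀ (linearization (B.hamiltonianVectorField H) z₀) = LinearMap.toMatrix'
      (fderiv ℝ (chartRepresentative φ (B.hamiltonianVectorField H)) (φ z₀)).toLinearMap :=
  matrixInChart_linearization hφ.mdifferentiable hφ.contMDiffAt_symm hφ.mem_source hH
    (hφ.differentiableAt_chartRepresentative H)

theorem toBlocks₁₁_matrixInChart_linearization (hφ : B.IsSplitChart φ z₀ Ω R)
    {H : C^∞⟮𝓘(ℝ, E), M; ℝ⟯} (hH : B.hamiltonianVectorField H z₀ = 0) :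
    (matrixInChart φ z₀ (linearization (B.hamiltonianVectorField H) z₀)).toBlocks₁₁ =
      Ω * (coordHessian (H ∘ φ.symm) (φ z₀)).toBlocks₁₁ := by
  rw [hφ.matrixInChart_linearization_eq_toMatrix' hH]
  refine toBlocks₁₁_toMatrix'_fderiv_of_eq_mul_coordGradient (hφ.contDiffAt_comp_symm H)
    (hφ.differentiableAt_chartRepresentative H) ?_
  filter_upwards [φ.open_target.mem_nhds (φ.map_source hφ.mem_source)] with y hy i
  rw [hφ.chartRepresentative_eq_mulVec H hy]
  simp [Matrix.mulVec, dotProduct]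

theorem toBlocks₂₁_matrixInChart_linearization (hφ : B.IsSplitChart φ z₀ Ω R)
    {H : C^∞⟮𝓘(ℝ, E), M; ℝ⟯} (hH : B.hamiltonianVectorField H z₀ = 0) :
    (matrixInChart φ z₀ (linearization (B.hamiltonianVectorField H) z₀)).toBlocks₂₁ = 0 := by
  rw [hφ.matrixInChart_linearization_eq_toMatrix' hH]
  refine toBlocks₂₁_toMatrix'_fderiv_eq_zero (hφ.differentiableAt_chartRepresentative H) ?_
  filter_upwards [φ.open_target.mem_nhds (φ.map_source hφ.mem_source)] with y hy hy_inr
  rw [hφ.chartRepresentative_eq_mulVec H hy, hy_inr, hφ.map_point, Matrix.fromBlocks_mulVec]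
  ext k
  simp

end PoissonStructure.IsSplitChart

end SplitChart

end PoissonDynamics

theorem proposition2p3_general {E : Type*} [NormedAddCommGroup E] [NormedSpace ℝ E]
    [FiniteDimensional ℝ E] {M : Type*} [TopologicalSpace M] [T2Space M] [ChartedSpace E M]
    [IsManifold 𝓘(ℝ, E) ∞ M] {B : PoissonStructure E M} {H : C^∞⟮𝓘(ℝ, E), M; ℝ⟯} {z_e : M}
    (h_eq : B.hamiltonianVectorField H z_e = 0) {a b : Type*} [Fintype a] [DecidableEq a]
    [Fintype b] [DecidableEq b] {φ : OpenPartialHomeomorph M (a ⊕ b → ℝ)} {Ω : Matrix a a ℝ}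
    {R : (b → ℝ) → Matrix b b ℝ} (hφ : B.IsSplitChart φ z_e Ω R) {A : Matrix (a ⊕ b) (a ⊕ b) ℝ}
    (hA : A = matrixInChart φ z_e (linearization (B.hamiltonianVectorField H) z_e))
    (h_passing : CoupledPassing A.toBlocks₁₁ A.toBlocks₁₂ A.toBlocks₂₂) :
    IsLinearlyUnstable (B.hamiltonianVectorField H) z_e := by
  intro hstable
  have hA₁₁ : A.toBlocks₁₁ = Ω * (coordHessian (H ∘ φ.symm) (φ z_e)).toBlocks₁₁ :=
    hA ▸ hφ.toBlocks₁₁_matrixInChart_linearization h_eq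
  have hA₂₁ : A.toBlocks₂₁ = 0 := hA ▸ hφ.toBlocks₂₁_matrixInChart_linearization h_eq
  have hA_stable : IsStableMatrix
      (Matrix.fromBlocks A.toBlocks₁₁ A.toBlocks₁₂ 0 A.toBlocks₂₂) := by
    rw [← hA₂₁, Matrix.fromBlocks_toBlocks, hA]
    exact hstable.isStableMatrix_matrixInChart hφ.mdifferentiable hφ.mem_source
  have hK : (coordHessian (H ∘ φ.symm) (φ z_e)).toBlocks₁₁.IsSymm :=
    (isSymm_coordHessian (hφ.contDiffAt_comp_symm H)).submatrix .inl
  refine hA_stable.not_coupledPassing ?_ h_passing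
  rw [hA₁₁, charpoly_neg_mul_of_isSymm hφ.transpose_eq_neg hK]

theorem proposition2p3 {E : Type*} [NormedAddCommGroup E] [NormedSpace ℝ E]
    [FiniteDimensional ℝ E] {M : Type*} [TopologicalSpace M] [T2Space M] [ChartedSpace E M]
    [IsManifold 𝓘(ℝ, E) ∞ M] (B : PoissonStructure E M) (H : C^∞⟮𝓘(ℝ, E), M; ℝ⟯) (z_e : M)
    (h_eq : B.hamiltonianVectorField H z_e = 0)
    {n r : ℕ} (φ : OpenPartialHomeomorph M (DWIndex n r → ℝ))
    (hφ : B.IsDarbouxWeinsteinChart φ z_e)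
    (h_passing : ExhibitsCoupledPassing (B.hamiltonianVectorField H) z_e φ) :
    IsLinearlyUnstable (B.hamiltonianVectorField H) z_e := by
  obtain ⟨R, hφ_split⟩ := hφ.exists_isSplitChart
  exact proposition2p3_general h_eq hφ_split rfl h_passing
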